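/- An inversion sequence of length $n$ is an integer sequence $e=(e_1,\dots,e_n)$ with $0\le e_i\le i-1$ for all $1\le i\le n$. Such a sequence avoids a pattern $p_1p_2p_3$ if there are no indices $i_1<i_2<i_3$ for which $e_{i_1}e_{i_2}e_{i_3}$ is order isomorphic to $p_1p_2p_3$. Let $\mathbf{I}_n(102,120)$ be the set of inversion sequences of length $n$ that avoid both $102$ and $120$. Let $b_{n,m,\ell}$ be the number of $e\in\mathbf{I}_n(102,120)$ whose largest entry is $m$ and for which the left-most occurrence of $m$ is in position $\ell$ (that is, $e_\ell=m$ and $e_i\ne m$ for $i<\ell$), and put $$b(x;u,v)=\sum_{n\ge 2}\ \sum_{\ell=2}^{n}\ \sum_{m=1}^{\ell-1} b_{n,m,\ell}\,u^m v^\ell x^n .$$ **Theorem.** As formal power series in $x$ over $\mathbb{Q}$, $$b(x;1,1)=\frac{x^2+x^2\sqrt{1-4x}}{(x-1)\bigl((3x-1)\sqrt{1-4x}-4x^2+5x-1\bigr)},$$ where $\sqrt{1-4x}$ is the formal power series with constant term $1$ whose square is $1-4x$, and the denominator is an invertible power series. Moreover, for every $n\ge 1$, $$|\mathbf{I}_n(102,120)|=1+\sum_{i=1}^{n-1}\binom{2i}{i-1}.$$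 -/

import Mathlib

namespace InvSeq

/-- Two words of the same length over `ℕ` are order isomorphic: their entries compare in the
same way (applied to `i, j` and to `j, i` this also says that equalities agree). -/
def OrderIsomorphic {k : ℕ} (w p : Fin k → ℕ) : Prop :=
  ∀ i j : Fin k, w i < w j ↔ p i < p j

/-- The word `w` contains the pattern `p`: some subword of `w`, at strictly increasing positions,
is order isomorphic to `p`. -/
def Contains {n k : ℕ} (w : Fin n → ℕ) (p : Fin k → ℕ) : Prop :=
  ∃ f : Fin k → Fin n, StrictMono f ∧ OrderIsomorphic (fun i => w (f i)) p

/-- The word `w` avoids the pattern `p`. -/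
def Avoids {n k : ℕ} (w : Fin n → ℕ) (p : Fin k → ℕ) : Prop :=
  ¬ Contains w p

/-- Inversion sequences of length `n`. With positions counted from `0`, the entry `e i` is the
`(i + 1)`-st one, so the usual condition `0 ≤ e_i ≤ i - 1` reads `e i ≤ i`. -/
def IsInversionSequence {n : ℕ} (e : Fin n → ℕ) : Prop :=
  ∀ i : Fin n, e i ≤ (i : ℕ)

/-- The set of inversion sequences of length `n` that avoid both patterns `p` and `q`. -/
def avoiders (n : ℕ) {k l : ℕ} (p : Fin k → ℕ) (q : Fin l → ℕ) : Set (Fin n → ℕ) :=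
  {e | IsInversionSequence e ∧ Avoids e p ∧ Avoids e q}

theorem avoiders_finite (n : ℕ) {k l : ℕ} (p : Fin k → ℕ) (q : Fin l → ℕ) :
    (avoiders n p q).Finite :=
  (Set.finite_Iic (fun i : Fin n => (i : ℕ))).subset fun _ he => he.1

/-- The largest entry of `e` is `m`, and the left-most occurrence of `m` in `e` is in position
`ℓ`, where positions are counted from `1`. -/
def LargestEntryAt {n : ℕ} (e : Fin n → ℕ) (m ℓ : ℕ) : Prop :=
  ∃ i : Fin n, (i : ℕ) + 1 = ℓ ∧ e i = m ∧ (∀ j, e j ≤ m) ∧ ∀ j, j < i → e j ≠ m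

/-- The `(102, 120)`-avoiding inversion sequences of length `n` whose largest entry is `m`, with
left-most occurrence of `m` in position `ℓ`. -/
def setB (n m ℓ : ℕ) : Set (Fin n → ℕ) :=
  {e | e ∈ avoiders n ![1, 0, 2] ![1, 2, 0] ∧ LargestEntryAt e m ℓ}

theorem setB_finite (n m ℓ : ℕ) : (setB n m ℓ).Finite :=
  (avoiders_finite n ![1, 0, 2] ![1, 2, 0]).subset fun _ he => he.1

/-- The number `b_{n,m,ℓ}`. -/
noncomputable def b (n m ℓ : ℕ) : ℕ :=
  (setB n m ℓ).ncard

/-- `b_n(u, v) = ∑_{ℓ=2}^{n} ∑_{m=1}^{ℓ-1} b_{n,m,ℓ} u^m v^ℓ`, where `u` and `v` may be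
indeterminates or numbers. -/
noncomputable def bPoly {R : Type*} [CommSemiring R] (n : ℕ) (u v : R) : R :=
  ∑ ℓ ∈ Finset.Icc 2 n, ∑ m ∈ Finset.Icc 1 (ℓ - 1), (b n m ℓ : R) * u ^ m * v ^ ℓ

/-- The generating function `b(x; u, v) = ∑_{n ≥ 2} b_n(u, v) x^n`, a formal power series in
`x`. -/
noncomputable def bGF {R : Type*} [CommSemiring R] (u v : R) : PowerSeries R :=
  PowerSeries.mk fun n => if 2 ≤ n then bPoly n u v else 0

end InvSeq

/-!
# Inversion sequences avoiding `102` and `120`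

A word avoids both patterns exactly when each of its entries is a lower bound or an upper bound of
everything to its right (`avoids_iff_isExtremalWord`); such a word is called extremal. Let `T(n, g)`
be the number of extremal words `w` of length `n` with `w i ≤ g + i`, and `U(n, k)` the number of
those with `w i ≤ k`. The avoiders are counted by `T(n, 0)`. Splitting off the first letter `v`
leaves a word that is bounded below by `v`, which after subtraction of `v` is of the first kind
again, or bounded above by `v`, which is of the second kind (`ncard_extremalWords_succ`). Taking
differences in `g` and `k` gives

* `U(n+1, k+1) + 1 = U(n+1, k) + 2 U(n, k+1)` and `U(n, 0) = 1`,
* `T(n+1, g+1) + 1 = T(n+1, g) + T(n, g+2) + U(n, g+1)` and `T(n+1, 0) = T(n, 1)`.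

For the generating functions in `n` these are linear recurrences with constant coefficients. The
first yields `2 ∑ (U(n, k) - 1) x ^ n = ((1 - 2x) ^ (-k) - 1) / (1 - x)` (`two_mul_boxGF`). The
second has at most one power series solution (`eq_zero_of_recurrence`), and an explicit one is a
combination of `(1 - 2x) ^ (-g)`, `1` and `C ^ g`, where `C = 1 + x C²` is the Catalan series. At
`g = 0` it becomes `∑ (T(n, 0) - 1) x ^ n = (xC)² / ((1 - x) √(1 - 4x))`
(`sqrtGF_mul_stairGF_zero`). As `x C² / √(1 - 4x)` is the generating function of
`(2n).choose (n - 1)`, `n ≥ 1` (`sqrtGF_mul_choose`), and the remaining factor `x / (1 - x)` takes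
shifted partial sums, this gives the number of avoiders.

The series `b(x; 1, 1)` counts all avoiders except the zero words (`sum_b_add_one`), so it is the
same series, and its stated form follows by algebra from `C = 1 + x C²` and `√(1 - 4x) = 1 - 2xC`.
-/

namespace InvSeq

/-! ### Extremal words -/

/-- Every entry of `w` is a lower bound or an upper bound of all the entries to its right. -/
def IsExtremalWord {n : ℕ} (w : Fin n → ℕ) : Prop :=
  ∀ i, (∀ j, i < j → w i ≤ w j) ∨ ∀ j, i < j → w j ≤ w i

/-- An entry with both a smaller and a larger entry to its right starts an occurrence of `102` or
of `120`, according to which of the two comes first. -/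
theorem avoids_iff_isExtremalWord {n : ℕ} (w : Fin n → ℕ) :
    Avoids w ![1, 0, 2] ∧ Avoids w ![1, 2, 0] ↔ IsExtremalWord w := by
  constructor
  · rintro ⟨h₁, h₂⟩ i
    by_contra! h
    obtain ⟨⟨j, hij, hj⟩, k, hik, hk⟩ := h
    rcases lt_trichotomy j k with hjk | rfl | hkj
    · refine h₁ ⟨![i, j, k], ?_, ?_⟩
      · rw [Fin.strictMono_iff_lt_succ]
        simp [Fin.forall_fin_succ, hij, hjk]
      · simp [OrderIsomorphic, Fin.forall_fin_succ]
        omega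
    · omega
    · refine h₂ ⟨![i, k, j], ?_, ?_⟩
      · rw [Fin.strictMono_iff_lt_succ]
        simp [Fin.forall_fin_succ, hik, hkj]
      · simp [OrderIsomorphic, Fin.forall_fin_succ]
        omega
  · intro h
    constructor
    all_goals
      rintro ⟨f, hf, hw⟩
      have h₁ := hf (show (0 : Fin 3) < 1 by decide)
      have h₂ := hf (show (0 : Fin 3) < 2 by decide)
      simp only [OrderIsomorphic, Fin.forall_fin_succ] at hw
      simp at hw
      rcases h (f 0) with h | h
      all_goals
        have := h _ h₁
        have := h _ h₂
        omega

theorem isExtremalWord_cons {n : ℕ} (v : ℕ) (w : Fin n → ℕ) :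
    IsExtremalWord (Fin.cons v w : Fin (n + 1) → ℕ) ↔
      ((∀ j, v ≤ w j) ∨ ∀ j, w j ≤ v) ∧ IsExtremalWord w := by
  simp [IsExtremalWord, Fin.forall_fin_succ]

/-- The extremal words dominated entrywise by `c`. -/
def extremalWords {n : ℕ} (c : Fin n → ℕ) : Set (Fin n → ℕ) :=
  {w | (∀ i, w i ≤ c i) ∧ IsExtremalWord w}

theorem extremalWords_finite {n : ℕ} (c : Fin n → ℕ) : (extremalWords c).Finite :=
  (Set.finite_Iic c).subset fun _ hw => hw.1

/-! ### Splitting off the first letter -/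

theorem ncard_eq_sum_ncard_cons {n k : ℕ} {S : Set (Fin (n + 1) → ℕ)} (hS : S.Finite)
    (hk : ∀ w ∈ S, w 0 ≤ k) :
    S.ncard = ∑ v ∈ Finset.range (k + 1),
      {w : Fin n → ℕ | (Fin.cons v w : Fin (n + 1) → ℕ) ∈ S}.ncard := by
  classical
  rw [Set.ncard_eq_toFinset_card S hS, Finset.card_eq_sum_card_fiberwise
    (f := fun w => w 0) (t := Finset.range (k + 1))]
  · refine Finset.sum_congr rfl fun v _ => ?_
    rw [← Set.ncard_coe_finset,
      ← Set.ncard_image_of_injective {w : Fin n → ℕ | (Fin.cons v w : Fin (n + 1) → ℕ) ∈ S}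
        (Fin.cons_right_injective (α := fun _ => ℕ) v)]
    congr 1
    ext w
    simp only [Finset.coe_filter, Set.Finite.mem_toFinset, Set.mem_ofPred_eq, Set.mem_image]
    constructor
    · rintro ⟨hw, rfl⟩
      exact ⟨Fin.tail w, by simpa using hw, by simp⟩
    · rintro ⟨w, hw, rfl⟩
      exact ⟨hw, by simp⟩
  · intro w hw
    simpa [Nat.lt_succ_iff] using hk w (by simpa using hw)

/-- The extremal words with first letter `v`, classified by their remaining part: it is bounded
below by `v` (subtract `v` everywhere) or above by `v`. Only the constant word `v` is both, whence
the `+ 1`. When it is bounded above by `v`, the constraint `c` is void because `v ≤ c 0`. -/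
theorem ncard_cons_extremalWords {n : ℕ} {c : Fin (n + 1) → ℕ} (hc : ∀ i, c 0 ≤ c i) {v : ℕ}
    (hv : v ≤ c 0) :
    {w : Fin n → ℕ | (Fin.cons v w : Fin (n + 1) → ℕ) ∈ extremalWords c}.ncard + 1 =
      (extremalWords fun i : Fin n => c i.succ - v).ncard +
        (extremalWords fun _ : Fin n => v).ncard := by
  have hinj : Function.Injective fun (w : Fin n → ℕ) i => v + w i := fun w w' h => by
    funext i
    simpa using congrFun h i
  rw [← Set.ncard_image_of_injective (extremalWords fun i : Fin n => c i.succ - v) hinj,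
    ← Set.ncard_union_add_ncard_inter _ _ ((extremalWords_finite _).image _)
      (extremalWords_finite _)]
  have hup : (fun (w : Fin n → ℕ) i => v + w i) '' (extremalWords fun i => c i.succ - v) =
      {w | (∀ i, v ≤ w i) ∧ (∀ i, w i ≤ c i.succ) ∧ IsExtremalWord w} := by
    ext w
    constructor
    · rintro ⟨w, ⟨hw, hw'⟩, rfl⟩
      refine ⟨fun i => by simp, fun i => ?_, by simpa [IsExtremalWord] using hw'⟩
      have := hw i
      have := hc i.succ
      dsimp only at *
      omega
    · rintro ⟨h₁, h₂, h₃⟩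
      refine ⟨fun i => w i - v, ⟨fun i => Nat.sub_le_sub_right (h₂ i) v, fun i => ?_⟩, ?_⟩
      · exact (h₃ i).imp (fun h j hj => Nat.sub_le_sub_right (h j hj) v)
          fun h j hj => Nat.sub_le_sub_right (h j hj) v
      · funext i
        have := h₁ i
        dsimp only
        omega
  rw [hup]
  congr 1
  · congr 1
    ext w
    simp only [extremalWords, Set.mem_ofPred_eq, isExtremalWord_cons, Fin.forall_fin_succ,
      Fin.cons_zero, Fin.cons_succ, Set.mem_union]
    have : (∀ i, w i ≤ v) → ∀ i : Fin n, w i ≤ c i.succ :=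
      fun h i => (h i).trans (hv.trans (hc _))
    tauto
  · rw [eq_comm, Set.ncard_eq_one]
    refine ⟨fun _ => v, ?_⟩
    ext w
    simp only [extremalWords, Set.mem_inter_iff, Set.mem_ofPred_eq, Set.mem_singleton_iff]
    constructor
    · rintro ⟨⟨h₁, -⟩, h₂, -⟩
      funext i
      exact le_antisymm (h₂ i) (h₁ i)
    · rintro rfl
      simpa [IsExtremalWord] using fun i : Fin n => hv.trans (hc i.succ)

theorem ncard_extremalWords_succ {n : ℕ} {c : Fin (n + 1) → ℕ} (hc : ∀ i, c 0 ≤ c i) :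
    (extremalWords c).ncard + (c 0 + 1) = ∑ v ∈ Finset.range (c 0 + 1),
      ((extremalWords fun i : Fin n => c i.succ - v).ncard +
        (extremalWords fun _ : Fin n => v).ncard) := by
  rw [ncard_eq_sum_ncard_cons (extremalWords_finite c) (k := c 0) fun w hw => hw.1 0]
  rw [← Finset.sum_congr rfl fun v hv =>
    ncard_cons_extremalWords hc (Nat.lt_succ_iff.1 (Finset.mem_range.1 hv))]
  simp [Finset.sum_add_distrib]

/-- The number of extremal words of length `n` over the alphabet `{0, …, k}`. -/
noncomputable def boxCount (n k : ℕ) : ℕ := (extremalWords fun _ : Fin n => k).ncard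

/-- The number of extremal words of length `n` whose `i`-th entry, counted from `0`, is at most
`g + i`. For `g = 0` these are the avoiders; a larger `g` is the head start that remains after
splitting off a letter and subtracting it. -/
noncomputable def stairCount (n g : ℕ) : ℕ := (extremalWords fun i : Fin n => g + i).ncard

/-- The avoiders are the extremal words below the staircase `0, 1, 2, …`; the summand `0` makes
the bound literally that of `stairCount n 0`. -/
theorem avoiders_eq_extremalWords (n : ℕ) :
    avoiders n ![1, 0, 2] ![1, 2, 0] = extremalWords fun i : Fin n => 0 + (i : ℕ) := by
  ext e
  simp only [avoiders, avoids_iff_isExtremalWord, Set.mem_ofPred_eq]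
  simp [extremalWords, IsInversionSequence]

theorem ncard_extremalWords_zero (c : Fin 0 → ℕ) : (extremalWords c).ncard = 1 := by
  rw [Set.ncard_eq_one]
  exact ⟨Fin.elim0, by ext w; simp [extremalWords, IsExtremalWord, Subsingleton.elim w Fin.elim0]⟩

theorem boxCount_letter_zero (n : ℕ) : boxCount n 0 = 1 := by
  rw [boxCount, Set.ncard_eq_one]
  refine ⟨0, ?_⟩
  ext w
  simp only [extremalWords, Nat.le_zero, Set.mem_ofPred_eq, Set.mem_singleton_iff]
  exact ⟨fun h => funext h.1, by rintro rfl; simp [IsExtremalWord]⟩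

theorem boxCount_succ_add (n k : ℕ) :
    boxCount (n + 1) k + (k + 1) = 2 * ∑ v ∈ Finset.range (k + 1), boxCount n v := by
  rw [boxCount, ncard_extremalWords_succ (by simp), Finset.sum_add_distrib, two_mul]
  congr 1
  rw [← Finset.sum_range_reflect]
  refine Finset.sum_congr rfl fun v hv => ?_
  rw [Finset.mem_range] at hv
  rw [boxCount]
  congr
  funext
  omega

theorem stairCount_succ_add (n g : ℕ) :
    stairCount (n + 1) g + (g + 1) =
      ∑ v ∈ Finset.range (g + 1), (stairCount n (g + 1 - v) + boxCount n v) := by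
  have h := ncard_extremalWords_succ (c := fun i : Fin (n + 1) => g + i) (by simp)
  simp only [Fin.val_zero, add_zero] at h
  rw [stairCount, h]
  refine Finset.sum_congr rfl fun v hv => ?_
  rw [Finset.mem_range] at hv
  rw [stairCount, boxCount]
  congr
  funext i
  rw [Fin.val_succ]
  omega

theorem boxCount_succ_succ (n k : ℕ) :
    boxCount (n + 1) (k + 1) + 1 = boxCount (n + 1) k + 2 * boxCount n (k + 1) := by
  have h₁ := boxCount_succ_add n k
  have h₂ := boxCount_succ_add n (k + 1)
  rw [Finset.sum_range_succ] at h₂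
  omega

theorem stairCount_succ_zero (n : ℕ) : stairCount (n + 1) 0 = stairCount n 1 := by
  have h := stairCount_succ_add n 0
  simp [boxCount_letter_zero] at h
  exact h

theorem stairCount_succ_succ (n g : ℕ) :
    stairCount (n + 1) (g + 1) + 1 =
      stairCount (n + 1) g + stairCount n (g + 2) + boxCount n (g + 1) := by
  have h₁ := stairCount_succ_add n g
  have h₂ := stairCount_succ_add n (g + 1)
  rw [Finset.sum_add_distrib] at h₁ h₂
  rw [Finset.sum_range_succ', Finset.sum_range_succ (fun v => boxCount n v)] at h₂
  simp only [Nat.add_sub_add_right, Nat.sub_zero] at h₂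
  rw [show g + 1 + 1 = g + 2 from rfl] at h₂
  omega

/-! ### Sorting the avoiders by their largest entry -/

theorem largestEntryAt_unique {n m m' ℓ ℓ' : ℕ} {e : Fin n → ℕ} (h : LargestEntryAt e m ℓ)
    (h' : LargestEntryAt e m' ℓ') : ℓ = ℓ' ∧ m = m' := by
  obtain ⟨i, rfl, rfl, hm, hi⟩ := h
  obtain ⟨j, rfl, rfl, hm', hj⟩ := h'
  have h := le_antisymm (hm' i) (hm j)
  rcases lt_trichotomy i j with hij | rfl | hij
  · exact absurd h (hj i hij)
  · simp
  · exact absurd h.symm (hi j hij)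

theorem exists_largestEntryAt {n : ℕ} [NeZero n] (e : Fin n → ℕ) :
    ∃ i : Fin n, LargestEntryAt e (e i) (i + 1) := by
  obtain ⟨a, ha⟩ := Finite.exists_max e
  let s := Finset.univ.filter fun i => e i = e a
  have hs : s.Nonempty := ⟨a, by simp [s]⟩
  have hmem : e (s.min' hs) = e a := (Finset.mem_filter.1 (s.min'_mem hs)).2
  -- Among the positions of the largest entry, take the left-most.
  refine ⟨s.min' hs, _, rfl, rfl, fun j => hmem ▸ ha j, fun j hj h => ?_⟩
  exact absurd (s.min'_le j (by simp [s, h, hmem])) (not_le.2 hj)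

/-- The zero word is the only avoider whose largest entry is `0`, so it is the only one that the
range of summation leaves out. -/
theorem sum_b_add_one {n : ℕ} (hn : 1 ≤ n) :
    ∑ ℓ ∈ Finset.Icc 2 n, ∑ m ∈ Finset.Icc 1 (ℓ - 1), b n m ℓ + 1 =
      (avoiders n ![1, 0, 2] ![1, 2, 0]).ncard := by
  classical
  have : NeZero n := ⟨by omega⟩
  have hfin := avoiders_finite n ![1, 0, 2] ![1, 2, 0]
  have h0 : (0 : Fin n → ℕ) ∈ hfin.toFinset := by
    rw [Set.Finite.mem_toFinset, avoiders_eq_extremalWords]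
    simp [extremalWords, IsExtremalWord]
  rw [Set.ncard_eq_toFinset_card _ hfin, ← Finset.card_erase_add_one h0,
    Finset.sum_sigma']
  congr 1
  simp_rw [b, Set.ncard_eq_toFinset_card _ (setB_finite _ _ _)]
  rw [← Finset.card_biUnion]
  · congr 1
    ext e
    simp only [Finset.mem_biUnion, Finset.mem_sigma, Finset.mem_Icc, Set.Finite.mem_toFinset,
      Finset.mem_erase, setB, Set.mem_ofPred_eq]
    constructor
    · rintro ⟨⟨ℓ, m⟩, h, he, i, -, hi, -⟩
      refine ⟨?_, he⟩
      rintro rfl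
      simp at hi h
      omega
    · rintro ⟨hne, he⟩
      obtain ⟨i, hi⟩ := exists_largestEntryAt e
      have hpos : e i ≠ 0 := fun h => hne <| funext fun j => by
        obtain ⟨-, -, -, hmax, -⟩ := hi
        simpa [h] using hmax j
      have := he.1 i
      exact ⟨⟨i + 1, e i⟩, by dsimp only; omega, he, hi⟩
  · rintro ⟨ℓ, m⟩ - ⟨ℓ', m'⟩ - hne
    refine Finset.disjoint_left.2 fun e he he' => hne ?_
    rw [Set.Finite.mem_toFinset] at he he'
    obtain ⟨rfl, rfl⟩ := largestEntryAt_unique he.2 he'.2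
    rfl

/-! ### The Catalan and central binomial series -/

open PowerSeries

/-- The generating function `C` of the Catalan numbers, over `ℚ`. -/
noncomputable def catalanGF : ℚ⟦X⟧ := mk fun n => (catalan n : ℚ)

/-- The series `√(1 - 4x)`, written as `1 - 2xC`. -/
noncomputable def sqrtGF : ℚ⟦X⟧ := 1 - 2 * X * catalanGF

theorem catalanGF_eq : catalanGF = 1 + X * catalanGF ^ 2 := by
  have h : catalanGF = PowerSeries.map (Nat.castRingHom ℚ) catalanSeries := by
    ext n
    simp [catalanGF]
  have h' := congrArg (PowerSeries.map (Nat.castRingHom ℚ)) catalanSeries_sq_mul_X_add_one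
  simp only [map_add, map_mul, map_pow, map_one, PowerSeries.map_X, ← h] at h'
  linear_combination -h'

theorem sqrtGF_sq : sqrtGF ^ 2 = 1 - 4 * X := by
  rw [sqrtGF]
  linear_combination -4 * X * catalanGF_eq

theorem constantCoeff_sqrtGF : constantCoeff sqrtGF = 1 := by
  simp [sqrtGF]

/-- The central binomial series is the derivative of `xC`, because
`(n + 1) * catalan n = centralBinom n`; differentiate `xC = x + (xC)²`. -/
theorem sqrtGF_mul_centralBinom :
    sqrtGF * (mk fun n => (n.centralBinom : ℚ)) = 1 := by
  have hK : (mk fun n => (n.centralBinom : ℚ)) = derivative ℚ (X * catalanGF) := by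
    ext n
    rw [coeff_derivative, coeff_succ_X_mul, catalanGF, coeff_mk, coeff_mk,
      ← succ_mul_catalan_eq_centralBinom]
    push_cast
    ring
  have h : X * catalanGF = X + (X * catalanGF) ^ 2 := by
    linear_combination X * catalanGF_eq
  have hd := congrArg (derivative ℚ) h
  rw [map_add, Derivation.leibniz_pow, derivative_X] at hd
  rw [hK, sqrtGF]
  simp only [smul_eq_mul, nsmul_eq_mul, pow_one, Nat.add_one_sub_one, Nat.cast_ofNat] at hd
  linear_combination hd

/-- Holds because `(2n).choose (n - 1) = centralBinom n - catalan n` for `n ≥ 1`. The value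
at `n = 0` is set apart because `n - 1` truncates there. -/
theorem sqrtGF_mul_choose :
    sqrtGF * (mk fun n => if n = 0 then 0 else ((2 * n).choose (n - 1) : ℚ)) =
      X * catalanGF ^ 2 := by
  have h : (mk fun n => if n = 0 then 0 else ((2 * n).choose (n - 1) : ℚ)) =
      (mk fun n => (n.centralBinom : ℚ)) - catalanGF := by
    ext n
    rw [map_sub, catalanGF, coeff_mk, coeff_mk, coeff_mk]
    rcases n with _ | n
    · simp
    · have h₁ : (2 * (n + 1)).choose (n + 1) * (n + 1) = (2 * (n + 1)).choose n * (n + 2) := by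
        rw [Nat.choose_succ_right_eq]
        congr 1
        omega
      have h₂ := succ_mul_catalan_eq_centralBinom (n + 1)
      rw [Nat.centralBinom_eq_two_mul_choose] at h₂ ⊢
      rw [if_neg n.succ_ne_zero, Nat.add_sub_cancel]
      qify at h₁ h₂
      have h₃ : (n + 2 : ℚ) ≠ 0 := by positivity
      refine mul_left_cancel₀ h₃ ?_
      linear_combination -h₁ + h₂
  rw [h]
  linear_combination (norm := (rw [sqrtGF]; ring)) sqrtGF_mul_centralBinom - catalanGF_eq

/-! ### Generating functions of the two counts -/

/-- The generating function, by length, of the nonzero words counted by `boxCount _ k`. -/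
noncomputable def boxGF (k : ℕ) : ℚ⟦X⟧ := mk fun n => (boxCount n k : ℚ) - 1

/-- The generating function, by length, of the nonzero words counted by `stairCount _ g`. -/
noncomputable def stairGF (g : ℕ) : ℚ⟦X⟧ := mk fun n => (stairCount n g : ℚ) - 1

theorem one_sub_mul_mk_one : (1 - X) * (mk 1 : ℚ⟦X⟧) = 1 := by
  rw [mul_comm]
  exact mk_one_mul_one_sub_eq_one ℚ

theorem boxGF_zero : boxGF 0 = 0 := by
  ext n
  simp [boxGF, boxCount_letter_zero]

theorem boxGF_succ (k : ℕ) :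
    boxGF (k + 1) = boxGF k + 2 * X * boxGF (k + 1) + X * mk 1 := by
  ext n
  rw [mul_assoc, ← map_ofNat C 2]
  rcases n with _ | n
  · simp [boxGF, boxCount, ncard_extremalWords_zero]
  · have h := boxCount_succ_succ n k
    qify at h
    simp only [boxGF, map_add, coeff_C_mul, coeff_succ_X_mul, coeff_mk, Pi.one_apply]
    linear_combination h

theorem stairGF_zero : stairGF 0 = X * stairGF 1 := by
  ext n
  rcases n with _ | n
  · simp [stairGF, stairCount, ncard_extremalWords_zero]
  · simp [stairGF, coeff_succ_X_mul, stairCount_succ_zero]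

theorem stairGF_succ (g : ℕ) :
    stairGF (g + 1) = stairGF g + X * (stairGF (g + 2) + boxGF (g + 1) + mk 1) := by
  ext n
  rcases n with _ | n
  · simp [stairGF, stairCount, ncard_extremalWords_zero]
  · have h := stairCount_succ_succ n g
    qify at h
    simp only [stairGF, boxGF, map_add, coeff_succ_X_mul, coeff_mk, Pi.one_apply]
    linear_combination h

/-- The homogeneous form of the equations satisfied by `stairGF` has only the zero solution. The
equations express the coefficient of `x ^ (n + 1)` in `d (g + 1)` by that in `d g` and by
coefficients of `x ^ n`, so no further boundary condition is needed. -/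
theorem eq_zero_of_recurrence {d : ℕ → ℚ⟦X⟧} (h0 : d 0 = X * d 1)
    (h : ∀ g, d (g + 1) = d g + X * d (g + 2)) (g : ℕ) : d g = 0 := by
  have key : ∀ n g, coeff n (d g) = 0 := by
    intro n
    induction n with
    | zero =>
      intro g
      induction g with
      | zero => simp [h0]
      | succ g ih => simpa [h g] using ih
    | succ n ihn =>
      intro g
      induction g with
      | zero => rw [h0, coeff_succ_X_mul, ihn]
      | succ g ih => rw [h g, map_add, coeff_succ_X_mul, ih, ihn, add_zero]
  ext n
  simpa using key n g

theorem two_mul_boxGF {u : ℚ⟦X⟧} (hu : (1 - 2 * X) * u = 1) (k : ℕ) :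
    2 * boxGF k = (u ^ k - 1) * mk 1 := by
  induction k with
  | zero => simp [boxGF_zero]
  | succ k ih =>
    have h := boxGF_succ k
    linear_combination 2 * u * h + u * ih - 2 * boxGF (k + 1) * hu - mk 1 * hu

/-! ### Solving the recurrence -/

/-- The recurrence of `stairGF` is linear in `g` with constant coefficients and characteristic
equation `x r² - r + 1 = 0`, of which `C` is the root that is a power series. Hence `stairGF` is a
particular solution plus a multiple of `C ^ g`. -/
theorem sqrtGF_mul_stairGF_zero :
    sqrtGF * stairGF 0 = (X * catalanGF) ^ 2 * mk 1 := by
  set s := sqrtGF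
  set c := catalanGF
  set y : ℚ⟦X⟧ := mk 1
  set σ : ℚ⟦X⟧ := mk fun n => (n.centralBinom : ℚ)
  obtain ⟨u, hu⟩ : ∃ u : ℚ⟦X⟧, (1 - 2 * X) * u = 1 :=
    ⟨(1 - 2 * X)⁻¹, PowerSeries.mul_inv_cancel _ (by simp)⟩
  have hσs : s * σ = 1 := sqrtGF_mul_centralBinom
  have hs2 : s ^ 2 = 1 - 4 * X := sqrtGF_sq
  have hcc : c = 1 + X * c ^ 2 := catalanGF_eq
  have hyy : (1 - X) * y = 1 := one_sub_mul_mk_one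
  have hσ2 : (1 - 4 * X) * σ ^ 2 = 1 := by
    rw [← hs2]
    linear_combination (s * σ + 1) * hσs
  have hsc : s = 1 - 2 * X * c := rfl
  -- Twice the explicit solution: the terms in `u ^ g` and `1` answer the inhomogeneous terms that
  -- come from `boxGF` and `mk 1`, and the coefficient of `c ^ g` is fixed by `stairGF_zero`.
  let P : ℕ → ℚ⟦X⟧ := fun g =>
    (1 - 2 * X) * y * σ ^ 2 * u ^ g - y + c * ((3 * X - 1) * y * σ ^ 2 + 1) * c ^ g
  have hd := eq_zero_of_recurrence (d := fun g => 2 * stairGF g - P g) ?_ ?_ 0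
  · simp only [P, pow_zero, mul_one] at hd
    have h2 : (2 : ℚ⟦X⟧) ≠ 0 := by
      rw [← map_ofNat C 2, Ne, map_eq_zero_iff _ C_injective]; norm_num
    have hs0 : s ≠ 0 := left_ne_zero_of_mul_eq_one hσs
    -- Multiplying by `s ^ 2` removes the inverses `σ` of `s`.
    refine mul_left_cancel₀ (mul_ne_zero h2 hs0) ?_
    linear_combination s ^ 2 * hd + ((1 - 2 * X) + c * (3 * X - 1)) * y * (s * σ + 1) * hσs +
      (c - y) * hs2 - c * (1 - 4 * X) * hyy - 2 * X ^ 2 * c ^ 2 * y * hsc -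
      2 * X * y * (1 + 2 * X * c) * hcc
  · simp only [P, pow_zero, pow_one, mul_one]
    linear_combination 2 * stairGF_zero - ((3 * X - 1) * y * σ ^ 2 + 1) * hcc +
      X * y * σ ^ 2 * hu + hyy
  · intro g
    have h1 := stairGF_succ g
    have h2 := two_mul_boxGF hu (g + 1)
    simp only [P]
    linear_combination 2 * h1 + X * h2 - c * ((3 * X - 1) * y * σ ^ 2 + 1) * c ^ g * hcc -
      (y * σ ^ 2 * u ^ g - X * y * σ ^ 2 * u * u ^ g - 2 * X * y * σ ^ 2 * u ^ g) * hu -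
      X * y * u * u ^ g * hσ2

theorem stairGF_zero_eq :
    stairGF 0 = X * (mk fun n => if n = 0 then 0 else ((2 * n).choose (n - 1) : ℚ)) * mk 1 := by
  have hs0 : sqrtGF ≠ 0 := left_ne_zero_of_mul_eq_one sqrtGF_mul_centralBinom
  refine mul_left_cancel₀ hs0 ?_
  linear_combination sqrtGF_mul_stairGF_zero - X * mk 1 * sqrtGF_mul_choose

/-- Multiplication by `1 / (1 - x)` takes partial sums of coefficients. -/
theorem ncard_avoiders {n : ℕ} (hn : 1 ≤ n) :
    (avoiders n ![1, 0, 2] ![1, 2, 0]).ncard =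
      1 + ∑ i ∈ Finset.Icc 1 (n - 1), (2 * i).choose (i - 1) := by
  obtain ⟨n, rfl⟩ := Nat.exists_eq_add_of_le' hn
  have h := congrArg (coeff (n + 1)) stairGF_zero_eq
  rw [mul_assoc, coeff_succ_X_mul, coeff_mul,
    Finset.Nat.sum_antidiagonal_eq_sum_range_succ_mk, Finset.sum_range_succ',
    stairGF, coeff_mk] at h
  simp only [coeff_mk, Pi.one_apply, mul_one, Nat.add_one_ne_zero, if_false, if_true, add_zero,
    Nat.add_sub_cancel] at h
  have hsum : ∑ i ∈ Finset.Icc 1 n, (2 * i).choose (i - 1) =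
      ∑ i ∈ Finset.range n, (2 * (i + 1)).choose i := by
    clear h hn
    induction n with
    | zero => simp
    | succ n ih =>
      rw [Finset.sum_Icc_succ_top (by omega), Finset.sum_range_succ, ih, Nat.add_sub_cancel]
  rw [avoiders_eq_extremalWords, ← stairCount, Nat.add_sub_cancel, hsum]
  qify
  linear_combination h

theorem bGF_one_one : bGF (1 : ℚ) 1 = stairGF 0 := by
  ext n
  have h : stairCount n 0 = (avoiders n ![1, 0, 2] ![1, 2, 0]).ncard := by
    rw [avoiders_eq_extremalWords, stairCount]
  rw [bGF, stairGF, coeff_mk, coeff_mk]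
  rcases lt_or_ge n 2 with hn | hn
  · rw [if_neg (by omega)]
    interval_cases n
    · simp [stairCount, ncard_extremalWords_zero]
    · simp [h, ncard_avoiders]
  · rw [if_pos hn, h, ← sum_b_add_one (by omega)]
    simp [bPoly]

end InvSeq

/-- In the first part `s` is the formal power series `√(1 - 4x)`, which is the unique square root
of `1 - 4x` with constant term `1`; the series inverted there is invertible. -/
theorem mainTheorem3 :
    (∃ s : PowerSeries ℚ,
      (s ^ 2 = 1 - 4 * PowerSeries.X ∧ PowerSeries.constantCoeff s = 1) ∧
      IsUnit ((PowerSeries.X - 1) *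
          ((3 * PowerSeries.X - 1) * s - 4 * PowerSeries.X ^ 2 + 5 * PowerSeries.X - 1)) ∧
      InvSeq.bGF (1 : ℚ) 1 =
        (PowerSeries.X ^ 2 + PowerSeries.X ^ 2 * s) *
          ((PowerSeries.X - 1) *
            ((3 * PowerSeries.X - 1) * s - 4 * PowerSeries.X ^ 2 + 5 * PowerSeries.X - 1))⁻¹) ∧
    ∀ n : ℕ, 1 ≤ n →
      (InvSeq.avoiders n ![1, 0, 2] ![1, 2, 0]).ncard =
        1 + ∑ i ∈ Finset.Icc 1 (n - 1), Nat.choose (2 * i) (i - 1) := by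
  have hden : PowerSeries.constantCoeff ((PowerSeries.X - 1) *
      ((3 * PowerSeries.X - 1) * InvSeq.sqrtGF - 4 * PowerSeries.X ^ 2 +
        5 * PowerSeries.X - 1)) = (2 : ℚ) := by
    simp [InvSeq.constantCoeff_sqrtGF]
    norm_num
  refine ⟨⟨InvSeq.sqrtGF, ⟨InvSeq.sqrtGF_sq, InvSeq.constantCoeff_sqrtGF⟩, ?_, ?_⟩,
    fun n hn => InvSeq.ncard_avoiders hn⟩
  · rw [PowerSeries.isUnit_iff_constantCoeff, hden]
    norm_num
  · rw [PowerSeries.eq_mul_inv_iff_mul_eq (by rw [hden]; norm_num), InvSeq.bGF_one_one]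
    have hs0 : InvSeq.sqrtGF ≠ 0 :=
      left_ne_zero_of_mul_eq_one InvSeq.sqrtGF_mul_centralBinom
    refine mul_left_cancel₀ hs0 ?_
    -- The factor `X - 1` cancels the `1 / (1 - x)` in `stairGF 0`. In terms of `C`, both sides are
    -- then polynomials in `x` and `C`, equal modulo `C = 1 + x C²`.
    linear_combination (norm := (simp only [InvSeq.sqrtGF]; ring))
      (PowerSeries.X - 1) * ((3 * PowerSeries.X - 1) * InvSeq.sqrtGF - 4 * PowerSeries.X ^ 2 +
        5 * PowerSeries.X - 1) * InvSeq.sqrtGF_mul_stairGF_zero -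
      PowerSeries.X ^ 2 * InvSeq.catalanGF ^ 2 * ((3 * PowerSeries.X - 1) * InvSeq.sqrtGF -
        4 * PowerSeries.X ^ 2 + 5 * PowerSeries.X - 1) * InvSeq.one_sub_mul_mk_one -
      PowerSeries.X ^ 2 * ((4 * PowerSeries.X - 2 - 2 * InvSeq.catalanGF +
        6 * PowerSeries.X * InvSeq.catalanGF) * InvSeq.catalanGF_eq + InvSeq.sqrtGF_sq)
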